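/- For real $q$ put $[n]_q=1+q+\dots+q^{n-1}$ (so $[0]_q=0$), $[n]_q!=\prod_{j=1}^n[j]_q$, and let $\left[{n\atop k}\right]_q=\frac{[n]_q!}{[n-k]_q!\,[k]_q!}$ for $0\le k\le n$ and $0$ otherwise. Let $H_n(\cdot|q)$ be the $q$-Hermite polynomials given by $H_0(x|q)=1$, $H_1(x|q)=x$ and $H_{n+1}(x|q)=xH_n(x|q)-[n]_qH_{n-1}(x|q)$ for $n\ge1$. Let $$I_k(x)=\sum_{m=0}^\infty\frac{(x/2)^{2m+k}}{m!\,(m+k)!}$$ be the modified Bessel function of the first kind of order $k\in\{0,1,2,\dots\}$. For integers $n\ge 1$ and $0\le m\le\lfloor n/2\rfloor$ let $$c_{m,n}(q)=\sum_{j=0}^m(-1)^jq^{j(j+1)/2}\left(\binom{n}{m-j}-\binom{n}{m-j-1}\right)\left[{n-2m+j\atop j}\right]_q,\qquad \binom{n}{-1}=0 .$$ (i) For all integers $n\ge1$ and $0\le m\le\lfloor n/2\rfloor$, $$\lim_{q\to1^-}\frac{c_{m,n}(q)}{(1-q)^m}=\frac{n!}{2^m\,m!\,(n-2m)!}.$$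 (ii) Let $t\in\mathbb R$, $t\neq0$. For every $q\in(-1,1)$ the series below converges absolutely, and $$\lim_{q\to1^-}\frac{\sqrt{1-q}}{t}\sum_{k=0}^\infty(-1)^kq^{\binom{k+1}{2}}(2k+1)\,I_{2k+1}\!\left(\frac{2t}{\sqrt{1-q}}\right)=\exp\left(\frac{t^2}{2}\right).$$ (iii) Let $t,y,\rho\in\mathbb R$ with $t\ne0$ and $|\rho|<1$. For every $q\in(-1,1)$ every inner series and the outer series below converge absolutely, and $$\lim_{q\to1^-}\frac{\sqrt{1-q}}{t}\sum_{k=0}^\infty\frac{(1-q)^{k/2}}{[k]_q!}\rho^kH_k(y|q)\sum_{j=0}^\infty(-1)^j\frac{[k+j]_q!\,(k+2j+1)}{[j]_q!}q^{j(j+1)/2}I_{2j+k+1}\!\left(\frac{2t}{\sqrt{1-q}}\right)=\exp\left(t\rho y+\frac{(1-\rho^2)t^2}{2}\right).$$ -/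

import Mathlib

open Filter Topology

noncomputable section

namespace QNormal

/-- The `q`-number `[n]_q = 1 + q + ⋯ + q^(n-1)`. -/
def qNumber (q : ℝ) (n : ℕ) : ℝ := ∑ i ∈ Finset.range n, q ^ i

/-- The `q`-factorial `[n]_q! = [1]_q [2]_q ⋯ [n]_q`. -/
def qFactorial (q : ℝ) (n : ℕ) : ℝ := ∏ j ∈ Finset.Icc 1 n, qNumber q j

/-- The `q`-binomial coefficient, `0` for `k > n`. -/
def qBinomial (q : ℝ) (n k : ℕ) : ℝ :=
  if k ≤ n then qFactorial q n / (qFactorial q (n - k) * qFactorial q k) else 0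

/-- The continuous `q`-Hermite polynomials (in the probabilistic normalization):
`H_0 = 1`, `H_1 = x`, `H_{n+1} = x H_n - [n]_q H_{n-1}`. -/
def qHermite (q x : ℝ) : ℕ → ℝ
  | 0 => 1
  | 1 => x
  | n + 2 => x * qHermite q x (n + 1) - qNumber q (n + 1) * qHermite q x n

/-- The difference `binom(n, k) - binom(n, k - 1)`, where `binom(n, -1) = 0`. -/
def chooseDiff (n k : ℕ) : ℝ :=
  (n.choose k : ℝ) - if k = 0 then 0 else (n.choose (k - 1) : ℝ)

/-- The coefficients `c_{m,n}(q)`, meant for `2 m ≤ n`. -/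
def coeffC (m n : ℕ) (q : ℝ) : ℝ :=
  ∑ j ∈ Finset.range (m + 1),
    (-1) ^ j * q ^ (j * (j + 1) / 2) * chooseDiff n (m - j) * qBinomial q (n - 2 * m + j) j

/-- The modified Bessel function of the first kind of order `k ∈ ℕ`
(so that `Γ(m + k + 1) = (m + k)!`). -/
def besselI (k : ℕ) (x : ℝ) : ℝ :=
  ∑' m : ℕ, (x / 2) ^ (2 * m + k) / ((m.factorial : ℝ) * ((m + k).factorial : ℝ))

/-- The series defining `besselI` converges everywhere. -/
theorem summable_besselI (k : ℕ) (x : ℝ) :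
    Summable fun m : ℕ =>
      (x / 2) ^ (2 * m + k) / ((m.factorial : ℝ) * ((m + k).factorial : ℝ)) := by
  have h := (Real.summable_pow_div_factorial (|x / 2| ^ 2)).mul_left (|x / 2| ^ k)
  refine Summable.of_norm_bounded h fun m => ?_
  have h1 : (1 : ℝ) ≤ ((m + k).factorial : ℝ) := by exact_mod_cast Nat.factorial_pos _
  have h2 : (0 : ℝ) < (m.factorial : ℝ) := by exact_mod_cast Nat.factorial_pos _
  rw [Real.norm_eq_abs, abs_div, abs_pow, abs_of_pos (by positivity : (0 : ℝ) <
    (m.factorial : ℝ) * ((m + k).factorial : ℝ)), ← mul_div_assoc, ← pow_mul, ← pow_add,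
    add_comm k]
  exact div_le_div_of_nonneg_left (by positivity) h2 (le_mul_of_one_le_right h2.le h1)

/-- The `k`-th term of the Bessel series for the moment generating function of the
`q`-normal distribution. -/
def termN (t q : ℝ) (k : ℕ) : ℝ :=
  (-1) ^ k * q ^ ((k + 1).choose 2) * (2 * (k : ℝ) + 1) *
    besselI (2 * k + 1) (2 * t / √(1 - q))

/-- The Bessel series `φ_N(t | q)`. -/
def phiN (t q : ℝ) : ℝ := √(1 - q) / t * ∑' k : ℕ, termN t q k

/-- The `j`-th term of the `k`-th inner series of the double Bessel series for the moment
generating function of the conditional `q`-normal distribution. -/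
def innerTermCN (t q : ℝ) (k j : ℕ) : ℝ :=
  (-1) ^ j * (qFactorial q (k + j) * ((k : ℝ) + 2 * j + 1) / qFactorial q j) *
    q ^ (j * (j + 1) / 2) * besselI (2 * j + k + 1) (2 * t / √(1 - q))

/-- The `k`-th term of the outer series, which contains the `k`-th inner series. -/
def outerTermCN (t y ρ q : ℝ) (k : ℕ) : ℝ :=
  (1 - q) ^ ((k : ℝ) / 2) / qFactorial q k * ρ ^ k * qHermite q y k *
    ∑' j : ℕ, innerTermCN t q k j

/-- The double Bessel series `φ_CN(t, y, ρ, q)`. -/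
def phiCN (t y ρ q : ℝ) : ℝ := √(1 - q) / t * ∑' k : ℕ, outerTermCN t y ρ q k

end QNormal

end

namespace QNormal

/-! Expand `x ^ n` in `q`-Hermite polynomials. The three-term recurrence forces the recursion
defining `hermiteCoeff`, and `coeffC_eq` shows that `c_{m,n}(q)` obeys it up to the factor `(1 - q)
^ m`; only the recursion is used, not the expansion itself. Since `hermiteCoeff` is a polynomial in
`q`, (i) is continuity at `1`. For (ii) and (iii), expand the Bessel functions and sum along
antidiagonals: the singular powers of `1 - q` cancel, and the `k`-th inner series becomes `expCoeff
t q k`, the coefficient of `H_k` in `exp (t * x)` (`tsum_innerTermCN`). The majorants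
`abs_hermiteCoeff_le` and `abs_qHermite_le` do not depend on `q`, so dominated convergence applies,
and the limit is the classical Hermite generating function times `exp (t ^ 2 / 2)`. -/

/-! ### `q`-analogues and binomial differences. -/

theorem qNumber_add (q : ℝ) (a b : ℕ) : qNumber q (a + b) = qNumber q a + q ^ a * qNumber q b := by
  simp [qNumber, Finset.sum_range_add, pow_add, Finset.mul_sum]

theorem qNumber_one (n : ℕ) : qNumber 1 n = n := by simp [qNumber]

theorem one_sub_mul_qNumber (q : ℝ) (n : ℕ) : (1 - q) * qNumber q n = 1 - q ^ n :=
  mul_neg_geom_sum q n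

theorem abs_qNumber_le {q : ℝ} (hq : |q| ≤ 1) (n : ℕ) : |qNumber q n| ≤ n := by
  refine (Finset.abs_sum_le_sum_abs _ _).trans ?_
  simpa using Finset.sum_le_card_nsmul (Finset.range n) (fun i => |q ^ i|) 1
    fun i _ => by rw [abs_pow]; exact pow_le_one₀ (abs_nonneg q) hq

theorem qNumber_succ_ne_zero {q : ℝ} (hq : |q| < 1) (n : ℕ) : qNumber q (n + 1) ≠ 0 := by
  intro h
  have h1 := one_sub_mul_qNumber q (n + 1)
  have h2 : |q ^ (n + 1)| < 1 := by
    rw [abs_pow]; exact pow_lt_one₀ (abs_nonneg q) hq n.succ_ne_zero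
  rw [h, mul_zero] at h1
  linarith [le_abs_self (q ^ (n + 1))]

@[fun_prop]
theorem continuous_qNumber (n : ℕ) : Continuous fun q : ℝ => qNumber q n := by
  unfold qNumber; fun_prop

theorem qFactorial_zero (q : ℝ) : qFactorial q 0 = 1 := by simp [qFactorial]

theorem qFactorial_succ (q : ℝ) (n : ℕ) :
    qFactorial q (n + 1) = qFactorial q n * qNumber q (n + 1) := by
  simp [qFactorial, Finset.prod_Icc_succ_top]

theorem qFactorial_ne_zero {q : ℝ} (hq : |q| < 1) (n : ℕ) : qFactorial q n ≠ 0 := by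
  induction n with
  | zero => simp [qFactorial_zero]
  | succ n ih => rw [qFactorial_succ]; exact mul_ne_zero ih (qNumber_succ_ne_zero hq n)

/-- The quotient is a product of `k` `q`-numbers. Bounding it as a whole matters for `q < 0`, where
`[j]_q!` can be less than `1`. -/
theorem abs_qFactorial_div_le {q : ℝ} (hq : |q| < 1) (k j : ℕ) :
    |qFactorial q (k + j) / qFactorial q j| ≤ ((k + j).factorial : ℝ) / (j.factorial : ℝ) := by
  induction k with
  | zero =>
    have := qFactorial_ne_zero hq j
    have h : (j.factorial : ℝ) ≠ 0 := by positivity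
    simp [this, h]
  | succ k ih =>
    have e : k + 1 + j = k + j + 1 := by omega
    rw [e, qFactorial_succ, Nat.factorial_succ, Nat.cast_mul, mul_comm ((k + j + 1 : ℕ) : ℝ),
      mul_div_right_comm, mul_div_right_comm, abs_mul]
    exact mul_le_mul ih (abs_qNumber_le hq.le _) (abs_nonneg _) (by positivity)

theorem qBinomial_add_left (q : ℝ) (l j : ℕ) :
    qBinomial q (l + j) j = qFactorial q (l + j) / (qFactorial q l * qFactorial q j) := by
  simp [qBinomial]

theorem qBinomial_zero_right {q : ℝ} (hq : |q| < 1) (n : ℕ) : qBinomial q n 0 = 1 := by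
  simp [qBinomial, qFactorial_zero, qFactorial_ne_zero hq n]

theorem qBinomial_self {q : ℝ} (hq : |q| < 1) (n : ℕ) : qBinomial q n n = 1 := by
  simp [qBinomial, qFactorial_zero, qFactorial_ne_zero hq n]

theorem qBinomial_pascal {q : ℝ} (hq : |q| < 1) (a j : ℕ) :
    qBinomial q (a + 1 + (j + 1)) (j + 1) =
      qBinomial q (a + (j + 1)) (j + 1) + q ^ (a + 1) * qBinomial q (a + 1 + j) j := by
  have h0 := qFactorial_ne_zero hq a
  have h1 := qFactorial_ne_zero hq j
  have h2 := qNumber_succ_ne_zero hq a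
  have h3 := qNumber_succ_ne_zero hq j
  have e : a + 1 + (j + 1) = a + j + 1 + 1 := by omega
  have e' : qNumber q (a + j + 1 + 1) = qNumber q (a + 1) + q ^ (a + 1) * qNumber q (j + 1) := by
    rw [← qNumber_add, e]
  simp only [qBinomial_add_left]
  rw [e, ← add_assoc a j 1, show a + 1 + j = a + j + 1 by omega, qFactorial_succ q (a + j + 1),
    qFactorial_succ q a, qFactorial_succ q j, e']
  field_simp

theorem one_sub_pow_mul_qBinomial {q : ℝ} (hq : |q| < 1) (l j : ℕ) :
    (1 - q ^ (l + j + 1)) * qBinomial q (l + j) j =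
      (1 - q ^ (l + 1)) * qBinomial q (l + 1 + j) j := by
  have h0 := qFactorial_ne_zero hq l
  have h1 := qFactorial_ne_zero hq j
  have h2 := qNumber_succ_ne_zero hq l
  simp only [qBinomial_add_left, ← one_sub_mul_qNumber]
  rw [show l + 1 + j = l + j + 1 by omega, qFactorial_succ q (l + j), qFactorial_succ q l]
  field_simp

theorem chooseDiff_zero_right (n : ℕ) : chooseDiff n 0 = 1 := by simp [chooseDiff]

theorem chooseDiff_succ_succ (n k : ℕ) :
    chooseDiff (n + 1) (k + 1) = chooseDiff n (k + 1) + chooseDiff n k := by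
  cases k with
  | zero => simp [chooseDiff]
  | succ k =>
    simp [chooseDiff, Nat.choose_succ_succ]
    ring

/-- Removes the unpaired `j = 0` term in `coeffC_succ_zero`. -/
theorem chooseDiff_middle (m : ℕ) : chooseDiff (2 * m + 1) (m + 1) = 0 := by
  simp [chooseDiff, Nat.choose_symm_half]

theorem chooseDiff_add (i p : ℕ) :
    chooseDiff (2 * i + p) i =
      (p + 1 : ℝ) * (2 * i + p).factorial / (i.factorial * (i + p + 1).factorial) := by
  cases i with
  | zero =>
    have : (p.factorial : ℝ) ≠ 0 := by positivity
    have : (p + 1 : ℝ) ≠ 0 := by positivity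
    simp [chooseDiff, Nat.factorial_succ]
    field_simp
  | succ i =>
    rw [chooseDiff, if_neg i.succ_ne_zero, Nat.add_sub_cancel,
      Nat.cast_choose ℝ (by omega), Nat.cast_choose ℝ (by omega),
      show 2 * (i + 1) + p - (i + 1) = i + p + 1 by omega,
      show 2 * (i + 1) + p - i = i + p + 1 + 1 by omega,
      show i + 1 + p + 1 = i + p + 1 + 1 by omega,
      Nat.factorial_succ i, Nat.factorial_succ (i + p + 1)]
    have h1 : (i.factorial : ℝ) ≠ 0 := by positivity
    have h2 : ((i + p + 1).factorial : ℝ) ≠ 0 := by positivity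
    have h3 : (i + 1 : ℝ) ≠ 0 := by positivity
    have h4 : (i + p + 1 + 1 : ℝ) ≠ 0 := by positivity
    push_cast
    field_simp
    ring

/-! ### Connection coefficients between monomials and `q`-Hermite polynomials. -/

/-- The coefficient of `H_l(x|q)` in the expansion of `x ^ (2 * m + l)`. -/
def hermiteCoeff (q : ℝ) : ℕ → ℕ → ℝ
  | 0, _ => 1
  | m + 1, 0 => hermiteCoeff q m 1
  | m + 1, l + 1 => hermiteCoeff q (m + 1) l + qNumber q (l + 2) * hermiteCoeff q m (l + 2)

theorem hermiteCoeff_one (m l : ℕ) :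
    hermiteCoeff 1 m l = ((2 * m + l).factorial : ℝ) / (2 ^ m * m.factorial * l.factorial) := by
  induction m generalizing l with
  | zero =>
    have : (l.factorial : ℝ) ≠ 0 := by positivity
    simp [hermiteCoeff, this]
  | succ m ihm =>
    have hm : (m.factorial : ℝ) ≠ 0 := by positivity
    have hm1 : (m + 1 : ℝ) ≠ 0 := by positivity
    induction l with
    | zero =>
      rw [hermiteCoeff, ihm, show 2 * (m + 1) + 0 = 2 * m + 1 + 1 by omega,
        Nat.factorial_succ (2 * m + 1), Nat.factorial_succ m]
      push_cast
      simp only [Nat.factorial_zero, Nat.factorial_one, Nat.cast_one]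
      field_simp
      ring
    | succ l ihl =>
      have hl : (l.factorial : ℝ) ≠ 0 := by positivity
      have hl1 : (l + 1 : ℝ) ≠ 0 := by positivity
      have hl2 : (l + 1 + 1 : ℝ) ≠ 0 := by positivity
      rw [hermiteCoeff, ihm, ihl, qNumber_one, show 2 * (m + 1) + (l + 1) = 2 * m + l + 2 + 1 by omega,
        show 2 * (m + 1) + l = 2 * m + l + 2 by omega, ← add_assoc,
        Nat.factorial_succ (2 * m + l + 2), Nat.factorial_succ m, Nat.factorial_succ (l + 1),
        Nat.factorial_succ l]
      push_cast
      field_simp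
      ring

/-- The recursion only adds and multiplies by `q`-numbers, so the triangle inequality passes through
it. -/
theorem abs_hermiteCoeff_le {q : ℝ} (hq : |q| ≤ 1) (m l : ℕ) :
    |hermiteCoeff q m l| ≤ hermiteCoeff 1 m l := by
  induction m generalizing l with
  | zero => simp [hermiteCoeff]
  | succ m ihm =>
    induction l with
    | zero => simpa only [hermiteCoeff] using ihm 1
    | succ l ihl =>
      rw [hermiteCoeff, hermiteCoeff, qNumber_one]
      refine (abs_add_le _ _).trans (add_le_add ihl ?_)
      rw [abs_mul]
      exact mul_le_mul (abs_qNumber_le hq _) (ihm _) (abs_nonneg _) (by positivity)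

@[fun_prop]
theorem continuous_hermiteCoeff (m l : ℕ) : Continuous fun q : ℝ => hermiteCoeff q m l := by
  induction m generalizing l with
  | zero => simp only [hermiteCoeff]; fun_prop
  | succ m ihm =>
    induction l with
    | zero => simpa only [hermiteCoeff] using ihm 1
    | succ l ihl =>
      simp only [hermiteCoeff]
      exact ihl.add ((continuous_qNumber _).mul (ihm _))

/-! ### Identification of `c_{m,n}(q)`. -/

theorem coeffC_add (m l : ℕ) (q : ℝ) : coeffC m (2 * m + l) q =
    ∑ j ∈ Finset.range (m + 1), (-1) ^ j * q ^ (j * (j + 1) / 2) *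
      chooseDiff (2 * m + l) (m - j) * qBinomial q (l + j) j := by
  simp [coeffC]

theorem triangle_succ (j : ℕ) : (j + 1) * (j + 1 + 1) / 2 = j * (j + 1) / 2 + (j + 1) := by
  rw [show (j + 1) * (j + 1 + 1) = j * (j + 1) + (j + 1) * 2 by ring, Nat.add_mul_div_right _ _ two_pos]

theorem coeffC_zero_left {q : ℝ} (hq : |q| < 1) (n : ℕ) : coeffC 0 n q = 1 := by
  simp [coeffC, chooseDiff_zero_right, qBinomial_zero_right hq]

theorem coeffC_succ_zero {q : ℝ} (hq : |q| < 1) (m : ℕ) :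
    coeffC (m + 1) (2 * (m + 1) + 0) q = (1 - q) * coeffC m (2 * m + 1) q := by
  rw [coeffC_add, coeffC_add, Finset.mul_sum]
  simp only [zero_add, qBinomial_self hq, mul_one]
  -- The index `j = m + 1` is excluded: there `m - j` truncates to `0`, where `chooseDiff` is `1`,
  -- while Pascal's rule would need `0`.
  have e : ∀ j ∈ Finset.range (m + 1),
      (-1) ^ j * q ^ (j * (j + 1) / 2) * chooseDiff (2 * (m + 1) + 0) (m + 1 - j) =
      (-1) ^ j * q ^ (j * (j + 1) / 2) * chooseDiff (2 * m + 1) (m + 1 - j) +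
      (-1) ^ j * q ^ (j * (j + 1) / 2) * chooseDiff (2 * m + 1) (m - j) := by
    intro j hj
    rw [Finset.mem_range] at hj
    rw [show m + 1 - j = m - j + 1 by omega, show 2 * (m + 1) + 0 = 2 * m + 1 + 1 by omega,
      chooseDiff_succ_succ]
    ring
  have e' := Finset.sum_range_succ (fun j => (-1) ^ j * q ^ (j * (j + 1) / 2) *
    chooseDiff (2 * m + 1) (m + 1 - j)) (m + 1)
  rw [Nat.sub_self, chooseDiff_zero_right] at e'
  rw [Finset.sum_range_succ, Finset.sum_congr rfl e, Finset.sum_add_distrib, Nat.sub_self,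
    chooseDiff_zero_right, add_right_comm, ← e', Finset.sum_range_succ', Nat.sub_zero, chooseDiff_middle,
    mul_zero, add_zero, ← Finset.sum_add_distrib]
  refine Finset.sum_congr rfl fun j _ => ?_
  have h := one_sub_pow_mul_qBinomial hq 0 j
  rw [zero_add, qBinomial_self hq, zero_add, pow_one, mul_one] at h
  rw [mul_left_comm, ← h, triangle_succ, pow_add, pow_succ, Nat.add_sub_add_right]
  ring

/-- Pascal's rule for `chooseDiff` splits the left side into two sums. After a shift of `j` in the
first, `q`-Pascal yields `c_{m+1,n}` plus a remainder; the remainder and the second sum combine with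
weight `1 - q ^ (l + j + 2)`, which `one_sub_pow_mul_qBinomial` trades for `1 - q ^ (l + 2)`. -/
theorem coeffC_succ_succ {q : ℝ} (hq : |q| < 1) (m l : ℕ) :
    coeffC (m + 1) (2 * (m + 1) + (l + 1)) q =
      coeffC (m + 1) (2 * (m + 1) + l) q +
        (1 - q ^ (l + 2)) * coeffC m (2 * m + (l + 2)) q := by
  rw [coeffC_add, coeffC_add, coeffC_add, Finset.mul_sum]
  have hn : 2 * m + (l + 2) = 2 * (m + 1) + l := by omega
  have hn' : 2 * (m + 1) + (l + 1) = 2 * (m + 1) + l + 1 := by omega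
  rw [hn, hn']
  set n := 2 * (m + 1) + l
  have e : ∀ j ∈ Finset.range (m + 1),
      (-1) ^ j * q ^ (j * (j + 1) / 2) * chooseDiff (n + 1) (m + 1 - j) *
        qBinomial q (l + 1 + j) j =
      (-1) ^ j * q ^ (j * (j + 1) / 2) * chooseDiff n (m + 1 - j) * qBinomial q (l + 1 + j) j +
      (-1) ^ j * q ^ (j * (j + 1) / 2) * chooseDiff n (m - j) * qBinomial q (l + 1 + j) j := by
    intro j hj
    rw [Finset.mem_range] at hj
    rw [show m + 1 - j = m - j + 1 by omega, chooseDiff_succ_succ]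
    ring
  have e' := Finset.sum_range_succ (fun j => (-1) ^ j * q ^ (j * (j + 1) / 2) *
    chooseDiff n (m + 1 - j) * qBinomial q (l + 1 + j) j) (m + 1)
  rw [Nat.sub_self, chooseDiff_zero_right] at e'
  rw [Finset.sum_range_succ, Finset.sum_congr rfl e, Finset.sum_add_distrib, Nat.sub_self,
    chooseDiff_zero_right, add_right_comm, ← e', Finset.sum_range_succ',
    Finset.sum_range_succ' _ (m + 1), qBinomial_zero_right hq, qBinomial_zero_right hq,
    add_right_comm, add_right_comm (∑ j ∈ Finset.range (m + 1), _) _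
      (∑ j ∈ Finset.range (m + 1), _), ← Finset.sum_add_distrib, ← Finset.sum_add_distrib]
  congr 1
  refine Finset.sum_congr rfl fun j _ => ?_
  have h := one_sub_pow_mul_qBinomial hq (l + 1) j
  rw [mul_left_comm (1 - q ^ (l + 2)), ← h, qBinomial_pascal hq, triangle_succ,
    pow_add q _ (j + 1), pow_succ (-1 : ℝ), Nat.add_sub_add_right]
  ring

theorem coeffC_eq {q : ℝ} (hq : |q| < 1) (m l : ℕ) :
    coeffC m (2 * m + l) q = (1 - q) ^ m * hermiteCoeff q m l := by
  induction m generalizing l with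
  | zero => simp [hermiteCoeff, coeffC_zero_left hq]
  | succ m ihm =>
    induction l with
    | zero => rw [coeffC_succ_zero hq, ihm, hermiteCoeff, pow_succ']; ring
    | succ l ihl =>
      rw [coeffC_succ_succ hq, ihl, ihm, hermiteCoeff, ← one_sub_mul_qNumber, pow_succ']; ring

theorem eventually_abs_lt_one : ∀ᶠ q : ℝ in 𝓝[<] 1, |q| < 1 := by
  filter_upwards [Ioo_mem_nhdsLT (show (-1 : ℝ) < 1 by norm_num)] with q hq
  exact abs_lt.2 hq

theorem tendsto_coeffC (m l : ℕ) :
    Tendsto (fun q : ℝ => coeffC m (2 * m + l) q / (1 - q) ^ m) (𝓝[<] 1)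
      (𝓝 (((2 * m + l).factorial : ℝ) / (2 ^ m * m.factorial * l.factorial))) := by
  rw [← hermiteCoeff_one]
  refine Tendsto.congr' ?_ ((continuous_hermiteCoeff m l).continuousWithinAt (s := Set.Iio 1))
  filter_upwards [eventually_abs_lt_one] with q hq
  rw [coeffC_eq hq, mul_div_cancel_left₀]
  exact pow_ne_zero _ (by linarith [(abs_lt.1 hq).2])

/-! ### Classical Hermite polynomials and their generating function. -/

/-- The polynomials `h_n` with exponential generating function `exp (s * y + σ * s ^ 2 / 2)`. -/
def hermiteSeq (y σ : ℝ) : ℕ → ℝ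
  | 0 => 1
  | 1 => y
  | n + 2 => y * hermiteSeq y σ (n + 1) + σ * (n + 1) * hermiteSeq y σ n

theorem qHermite_one (y : ℝ) (n : ℕ) : qHermite 1 y n = hermiteSeq y (-1) n := by
  induction n using Nat.twoStepInduction with
  | zero => rfl
  | one => rfl
  | more n ih1 ih2 =>
    rw [qHermite, hermiteSeq, ih1, ih2, qNumber_one]
    push_cast
    ring

/-- Making all signs in the recurrence positive gives the case `σ = 1`, whose generating function
still converges everywhere. -/
theorem abs_qHermite_le {q : ℝ} (hq : |q| ≤ 1) (y : ℝ) (n : ℕ) :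
    |qHermite q y n| ≤ hermiteSeq |y| 1 n := by
  induction n using Nat.twoStepInduction with
  | zero => simp [qHermite, hermiteSeq]
  | one => simp [qHermite, hermiteSeq]
  | more n ih1 ih2 =>
    rw [qHermite, hermiteSeq, one_mul]
    refine (abs_sub _ _).trans (add_le_add ?_ ?_)
    · rw [abs_mul]
      exact mul_le_mul_of_nonneg_left ih2 (abs_nonneg y)
    · rw [abs_mul]
      refine mul_le_mul ?_ ih1 (abs_nonneg _) (by positivity)
      exact_mod_cast abs_qNumber_le hq (n + 1)

theorem continuous_qHermite (y : ℝ) (n : ℕ) : Continuous fun q : ℝ => qHermite q y n := by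
  induction n using Nat.twoStepInduction with
  | zero => simp only [qHermite]; fun_prop
  | one => simp only [qHermite]; fun_prop
  | more n ih1 ih2 => simp only [qHermite]; fun_prop

theorem hasSum_pow_div_factorial (x : ℝ) :
    HasSum (fun n : ℕ => x ^ n / (n.factorial : ℝ)) (Real.exp x) := by
  rw [Real.exp_eq_exp_ℝ]
  exact NormedSpace.expSeries_div_hasSum_exp x

/-- The Taylor coefficients at `0` of `x ↦ exp (c * x ^ 2)`. -/
noncomputable def gaussCoeff (c : ℝ) (n : ℕ) : ℝ :=
  if Even n then c ^ (n / 2) / ((n / 2).factorial : ℝ) else 0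

theorem hasSum_gaussCoeff (c : ℝ) : HasSum (gaussCoeff c) (Real.exp c) := by
  have hinj : Function.Injective fun n : ℕ => 2 * n := fun a b h => by simpa using h
  refine (hinj.hasSum_iff fun n hn => ?_).1 ?_
  · refine if_neg fun h => hn ?_
    obtain ⟨k, rfl⟩ := h
    exact ⟨k, by simp only; omega⟩
  · convert hasSum_pow_div_factorial c using 2 with n
    simp [gaussCoeff]

theorem gaussCoeff_add_two (c : ℝ) (n : ℕ) :
    gaussCoeff c (n + 2) * (n + 2) = 2 * c * gaussCoeff c n := by
  unfold gaussCoeff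
  by_cases h : Even n
  · have h' : Even (n + 2) := h.add even_two
    obtain ⟨k, rfl⟩ := h
    have hk : (k.factorial : ℝ) ≠ 0 := by positivity
    have hk1 : (k + 1 : ℝ) ≠ 0 := by positivity
    rw [if_pos h', if_pos ⟨k, rfl⟩, show (k + k + 2) / 2 = k + 1 by omega,
      show (k + k) / 2 = k by omega, Nat.factorial_succ]
    push_cast
    field_simp
    ring
  · have h' : ¬ Even (n + 2) := by simpa [Nat.even_add] using h
    rw [if_neg h, if_neg h']
    ring

open PowerSeries in
theorem derivative_mk_gaussCoeff (c : ℝ) :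
    d⁄dX ℝ (mk (gaussCoeff c)) = C (2 * c) * (X * mk (gaussCoeff c)) := by
  ext n
  rw [coeff_derivative, coeff_mk, coeff_C_mul]
  cases n with
  | zero => simp [gaussCoeff]
  | succ n =>
    rw [coeff_succ_X_mul, coeff_mk, ← gaussCoeff_add_two]
    push_cast
    ring

open PowerSeries in
theorem derivative_mk_pow_div_factorial (x : ℝ) :
    d⁄dX ℝ (mk fun n => x ^ n / (n.factorial : ℝ)) =
      C x * mk fun n => x ^ n / (n.factorial : ℝ) := by
  ext n
  have hn : (n.factorial : ℝ) ≠ 0 := by positivity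
  have hn1 : (n + 1 : ℝ) ≠ 0 := by positivity
  rw [coeff_derivative, coeff_mk, coeff_C_mul, coeff_mk, Nat.factorial_succ, pow_succ']
  push_cast
  field_simp

open PowerSeries in
-- The product series `F` satisfies `F' = (s * y + σ * s ^ 2 * X) * F`; comparing coefficients gives
-- the recurrence of `hermiteSeq`.
theorem sum_antidiagonal_gaussCoeff_mul (y σ s : ℝ) (n : ℕ) :
    ∑ p ∈ Finset.HasAntidiagonal.antidiagonal n,
      gaussCoeff (σ * s ^ 2 / 2) p.1 * ((s * y) ^ p.2 / (p.2.factorial : ℝ)) =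
    hermiteSeq y σ n * s ^ n / (n.factorial : ℝ) := by
  set G : ℝ⟦X⟧ := mk (gaussCoeff (σ * s ^ 2 / 2)) with hG
  set A : ℝ⟦X⟧ := mk fun n => (s * y) ^ n / (n.factorial : ℝ) with hA
  have hc (n : ℕ) : ∑ p ∈ Finset.HasAntidiagonal.antidiagonal n,
      gaussCoeff (σ * s ^ 2 / 2) p.1 * ((s * y) ^ p.2 / (p.2.factorial : ℝ)) = coeff n (G * A) := by
    simp [coeff_mul, hG, hA]
  have hd : d⁄dX ℝ (G * A) = C (s * y) * (G * A) + C (σ * s ^ 2) * (X * (G * A)) := by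
    rw [Derivation.leibniz, derivative_mk_gaussCoeff, derivative_mk_pow_div_factorial,
      mul_div_cancel₀ _ (two_ne_zero' ℝ)]
    simp only [smul_eq_mul]
    ring
  rw [hc]
  induction n using Nat.twoStepInduction with
  | zero => simp [hG, hA, gaussCoeff, hermiteSeq]
  | one =>
    rw [← hc]
    simp [Finset.Nat.antidiagonal_succ, gaussCoeff, hermiteSeq, mul_comm]
  | more n ih1 ih2 =>
    have h := congrArg (coeff (n + 1)) hd
    rw [coeff_derivative, map_add, coeff_C_mul, coeff_C_mul, coeff_succ_X_mul, ih1, ih2] at h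
    have hn : (n.factorial : ℝ) ≠ 0 := by positivity
    have hn1 : (n + 1 : ℝ) ≠ 0 := by positivity
    have hn2 : (n + 1 + 1 : ℝ) ≠ 0 := by positivity
    push_cast at h
    rw [eq_div_of_mul_eq hn2 h, hermiteSeq, Nat.factorial_succ (n + 1), Nat.factorial_succ n]
    push_cast
    field_simp
    ring

theorem hasSum_hermiteSeq (y σ s : ℝ) :
    HasSum (fun n => hermiteSeq y σ n * s ^ n / (n.factorial : ℝ))
      (Real.exp (s * y + σ * s ^ 2 / 2)) := by
  have hg := hasSum_gaussCoeff (σ * s ^ 2 / 2)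
  have ha := hasSum_pow_div_factorial (s * y)
  have h1 := (summable_norm_sum_mul_antidiagonal_of_summable_norm hg.summable.norm
    ha.summable.norm).of_norm
  have h2 := tsum_mul_tsum_eq_tsum_sum_antidiagonal_of_summable_norm hg.summable.norm
    ha.summable.norm
  rw [hg.tsum_eq, ha.tsum_eq, ← Real.exp_add, add_comm] at h2
  simp only [sum_antidiagonal_gaussCoeff_mul] at h1 h2
  rw [h2]
  exact h1.hasSum

/-! ### Expansion of the exponential and dominated convergence. -/

/-- The coefficient of `H_k(x|q)` in the expansion of `exp (t * x)`. -/
noncomputable def expCoeff (t q : ℝ) (k : ℕ) : ℝ :=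
  ∑' m : ℕ, t ^ (2 * m + k) / ((2 * m + k).factorial : ℝ) * hermiteCoeff q m k

theorem pow_div_factorial_mul_hermiteCoeff_one (t : ℝ) (k m : ℕ) :
    t ^ (2 * m + k) / ((2 * m + k).factorial : ℝ) * hermiteCoeff 1 m k =
      t ^ k / (k.factorial : ℝ) * ((t ^ 2 / 2) ^ m / (m.factorial : ℝ)) := by
  rw [hermiteCoeff_one, pow_add, pow_mul, div_pow]
  have : ((2 * m + k).factorial : ℝ) ≠ 0 := by positivity
  field_simp

theorem hasSum_expCoeff_one (t : ℝ) (k : ℕ) :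
    HasSum (fun m : ℕ => t ^ (2 * m + k) / ((2 * m + k).factorial : ℝ) * hermiteCoeff 1 m k)
      (t ^ k / (k.factorial : ℝ) * Real.exp (t ^ 2 / 2)) := by
  simp only [pow_div_factorial_mul_hermiteCoeff_one]
  exact (hasSum_pow_div_factorial _).mul_left _

theorem norm_expCoeff_term_le {q : ℝ} (hq : |q| ≤ 1) (t : ℝ) (k m : ℕ) :
    ‖t ^ (2 * m + k) / ((2 * m + k).factorial : ℝ) * hermiteCoeff q m k‖ ≤
      |t| ^ (2 * m + k) / ((2 * m + k).factorial : ℝ) * hermiteCoeff 1 m k := by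
  rw [Real.norm_eq_abs, abs_mul, abs_div, abs_pow, Nat.abs_cast]
  exact mul_le_mul_of_nonneg_left (abs_hermiteCoeff_le hq m k) (by positivity)

theorem abs_expCoeff_le {q : ℝ} (hq : |q| ≤ 1) (t : ℝ) (k : ℕ) :
    |expCoeff t q k| ≤ |t| ^ k / (k.factorial : ℝ) * Real.exp (t ^ 2 / 2) := by
  have h := hasSum_expCoeff_one |t| k
  rw [sq_abs] at h
  exact tsum_of_norm_bounded h (norm_expCoeff_term_le hq t k)

theorem tendsto_expCoeff (t : ℝ) (k : ℕ) :
    Tendsto (fun q => expCoeff t q k) (𝓝[<] 1)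
      (𝓝 (t ^ k / (k.factorial : ℝ) * Real.exp (t ^ 2 / 2))) := by
  rw [← (hasSum_expCoeff_one t k).tsum_eq]
  refine tendsto_tsum_of_dominated_convergence (hasSum_expCoeff_one |t| k).summable
    (fun m => ?_) ?_
  · exact ((continuous_hermiteCoeff m k).continuousWithinAt (s := Set.Iio 1)).const_mul _
  · filter_upwards [eventually_abs_lt_one] with q hq m
    exact norm_expCoeff_term_le hq.le t k m

theorem norm_hermite_expCoeff_le {q : ℝ} (hq : |q| ≤ 1) (t y ρ : ℝ) (k : ℕ) :
    ‖ρ ^ k * qHermite q y k * expCoeff t q k‖ ≤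
      hermiteSeq |y| 1 k * (|ρ| * |t|) ^ k / (k.factorial : ℝ) * Real.exp (t ^ 2 / 2) := by
  rw [Real.norm_eq_abs, abs_mul, abs_mul, abs_pow]
  have h0 : 0 ≤ hermiteSeq |y| 1 k := (abs_nonneg _).trans (abs_qHermite_le hq y k)
  calc |ρ| ^ k * |qHermite q y k| * |expCoeff t q k|
      ≤ |ρ| ^ k * hermiteSeq |y| 1 k * (|t| ^ k / (k.factorial : ℝ) * Real.exp (t ^ 2 / 2)) := by
        gcongr
        · exact abs_qHermite_le hq y k
        · exact abs_expCoeff_le hq t k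
    _ = _ := by rw [mul_pow]; ring

theorem summable_hermite_expCoeff_bound (t y ρ : ℝ) :
    Summable fun k : ℕ =>
      hermiteSeq |y| 1 k * (|ρ| * |t|) ^ k / (k.factorial : ℝ) * Real.exp (t ^ 2 / 2) :=
  (hasSum_hermiteSeq |y| 1 (|ρ| * |t|)).summable.mul_right _

theorem summable_hermite_expCoeff {q : ℝ} (hq : |q| ≤ 1) (t y ρ : ℝ) :
    Summable fun k => ρ ^ k * qHermite q y k * expCoeff t q k :=
  .of_norm_bounded (summable_hermite_expCoeff_bound t y ρ) (norm_hermite_expCoeff_le hq t y ρ)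

theorem tendsto_tsum_hermite_expCoeff (t y ρ : ℝ) :
    Tendsto (fun q => ∑' k, ρ ^ k * qHermite q y k * expCoeff t q k) (𝓝[<] 1)
      (𝓝 (Real.exp (t * ρ * y + (1 - ρ ^ 2) * t ^ 2 / 2))) := by
  have h := (hasSum_hermiteSeq y (-1) (t * ρ)).mul_right (Real.exp (t ^ 2 / 2))
  have e (k : ℕ) : hermiteSeq y (-1) k * (t * ρ) ^ k / (k.factorial : ℝ) * Real.exp (t ^ 2 / 2) =
      ρ ^ k * qHermite 1 y k * (t ^ k / (k.factorial : ℝ) * Real.exp (t ^ 2 / 2)) := by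
    rw [qHermite_one, mul_pow]
    ring
  rw [funext e, ← Real.exp_add, show t * ρ * y + -1 * (t * ρ) ^ 2 / 2 + t ^ 2 / 2 =
    t * ρ * y + (1 - ρ ^ 2) * t ^ 2 / 2 by ring] at h
  rw [← h.tsum_eq]
  refine tendsto_tsum_of_dominated_convergence (summable_hermite_expCoeff_bound t y ρ)
    (fun k => ?_) ?_
  · exact Tendsto.mul
      (((continuous_qHermite y k).continuousWithinAt (s := Set.Iio 1)).const_mul (ρ ^ k))
      (tendsto_expCoeff t k)
  · filter_upwards [eventually_abs_lt_one] with q hq k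
    exact norm_hermite_expCoeff_le hq.le t y ρ k

/-! ### Rearrangement of the Bessel series. -/

/-- The terms of the double series that arises from `innerTermCN` by expanding the Bessel
functions at `2 * s`. -/
noncomputable def besselTerm (q s : ℝ) (k : ℕ) (p : ℕ × ℕ) : ℝ :=
  (-1) ^ p.1 * (qFactorial q (k + p.1) * ((k : ℝ) + 2 * p.1 + 1) / qFactorial q p.1) *
    q ^ (p.1 * (p.1 + 1) / 2) *
    (s ^ (2 * p.2 + (2 * p.1 + k + 1)) /
      ((p.2.factorial : ℝ) * ((p.2 + (2 * p.1 + k + 1)).factorial : ℝ)))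

/-- The Bessel factorial absorbs both the `q`-factorial quotient and the linear factor, leaving a
product of two exponential series. -/
theorem norm_besselTerm_le {q : ℝ} (hq : |q| < 1) (s : ℝ) (k : ℕ) (p : ℕ × ℕ) :
    ‖besselTerm q s k p‖ ≤ |s| ^ (k + 1) *
      ((|s| ^ 2) ^ p.1 / (p.1.factorial : ℝ) * ((|s| ^ 2) ^ p.2 / (p.2.factorial : ℝ))) := by
  obtain ⟨j, i⟩ := p
  have hfac : ((k + j).factorial : ℝ) * ((k : ℝ) + 2 * j + 1) ≤
      ((i + (2 * j + k + 1)).factorial : ℝ) := by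
    have h1 : (k + j).factorial * (2 * j + k + 1) ≤ (2 * j + k + 1).factorial := by
      rw [Nat.factorial_succ, mul_comm]
      exact Nat.mul_le_mul_left _ (Nat.factorial_le (by omega))
    have h2 := h1.trans (Nat.factorial_le (Nat.le_add_left (2 * j + k + 1) i))
    calc ((k + j).factorial : ℝ) * ((k : ℝ) + 2 * j + 1)
        = (((k + j).factorial * (2 * j + k + 1) : ℕ) : ℝ) := by push_cast; ring
      _ ≤ _ := by exact_mod_cast h2
  have hq1 : |q| ^ (j * (j + 1) / 2) ≤ 1 := pow_le_one₀ (abs_nonneg q) hq.le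
  have hk : 0 ≤ (k : ℝ) + 2 * j + 1 := by positivity
  have hF := abs_qFactorial_div_le hq k j
  simp only [besselTerm, Real.norm_eq_abs]
  rw [mul_div_right_comm, abs_mul, abs_mul, abs_mul, abs_mul, abs_pow, abs_neg, abs_one, one_pow,
    one_mul, abs_of_nonneg hk, abs_pow, abs_div (s ^ _), abs_pow, abs_mul, Nat.abs_cast, Nat.abs_cast]
  calc _ ≤ ((k + j).factorial : ℝ) / (j.factorial : ℝ) * ((k : ℝ) + 2 * j + 1) * 1 *
        (|s| ^ (2 * i + (2 * j + k + 1)) /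
          ((i.factorial : ℝ) * (((k + j).factorial : ℝ) * ((k : ℝ) + 2 * j + 1)))) := by gcongr
    _ = _ := by
      have h1 : ((k + j).factorial : ℝ) ≠ 0 := by positivity
      have h2 : (k : ℝ) + 2 * j + 1 ≠ 0 := by positivity
      field_simp
      ring

theorem summable_besselTerm {q : ℝ} (hq : |q| < 1) (s : ℝ) (k : ℕ) :
    Summable (besselTerm q s k) := by
  have h := Real.summable_pow_div_factorial (|s| ^ 2)
  exact .of_norm_bounded ((summable_mul_of_summable_norm h.norm h.norm).mul_left (|s| ^ (k + 1)))
    (norm_besselTerm_le hq s k)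

/-- On `j + i = m` the power of `s` is constant, and by `chooseDiff_add` the factorials become
`chooseDiff (2 * m + k) i / (2 * m + k)!`, so the sum is a multiple of `c_{m,2m+k}(q)`. -/
theorem sum_antidiagonal_besselTerm {q : ℝ} (hq : |q| < 1) (s : ℝ) (k m : ℕ) :
    ∑ p ∈ Finset.HasAntidiagonal.antidiagonal m, besselTerm q s k p =
      s ^ (2 * m + k + 1) / ((2 * m + k).factorial : ℝ) * qFactorial q k *
        ((1 - q) ^ m * hermiteCoeff q m k) := by
  rw [← coeffC_eq hq, coeffC_add, Finset.mul_sum, Finset.Nat.sum_antidiagonal_eq_sum_range_succ_mk]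
  refine Finset.sum_congr rfl fun j hj => ?_
  obtain ⟨i, rfl⟩ := Nat.exists_eq_add_of_le (Nat.lt_succ_iff.1 (Finset.mem_range.1 hj))
  have h1 : (i.factorial : ℝ) ≠ 0 := by positivity
  have h2 : ((i + (2 * j + k + 1)).factorial : ℝ) ≠ 0 := by positivity
  have h3 : ((2 * i + (2 * j + k)).factorial : ℝ) ≠ 0 := by positivity
  have h4 := qFactorial_ne_zero hq k
  have h5 := qFactorial_ne_zero hq j
  rw [Nat.add_sub_cancel_left, show 2 * (j + i) + k = 2 * i + (2 * j + k) by omega,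
    chooseDiff_add, qBinomial_add_left, besselTerm, ← add_assoc i (2 * j + k) 1] at *
  push_cast
  simp only [← add_assoc] at *
  field_simp
  ring

theorem tsum_eq_tsum_antidiagonal {f : ℕ × ℕ → ℝ} (hf : Summable f) :
    ∑' j, ∑' i, f (j, i) = ∑' m, ∑ p ∈ Finset.HasAntidiagonal.antidiagonal m, f p := by
  conv_rhs => congr; ext; rw [← Finset.sum_finset_coe, ← tsum_fintype (L := .unconditional _)]
  rw [← hf.tsum_prod, ← Finset.HasAntidiagonal.sigmaAntidiagonalEquivProd.tsum_eq f]
  exact (Finset.HasAntidiagonal.sigmaAntidiagonalEquivProd.summable_iff.2 hf).tsum_sigma'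
    fun n => (hasSum_fintype _).summable

theorem innerTermCN_eq_tsum (t q : ℝ) (k j : ℕ) :
    innerTermCN t q k j = ∑' i, besselTerm q (t / √(1 - q)) k (j, i) := by
  simp only [innerTermCN, besselTerm, besselI]
  rw [tsum_mul_left, show 2 * t / √(1 - q) / 2 = t / √(1 - q) by ring]

theorem summable_innerTermCN {q : ℝ} (hq : |q| < 1) (t : ℝ) (k : ℕ) :
    Summable (innerTermCN t q k) := by
  simp only [funext (innerTermCN_eq_tsum t q k)]
  exact (summable_besselTerm hq _ k).prod

theorem tsum_innerTermCN {q t : ℝ} (hq : |q| < 1) (ht : t ≠ 0) (k : ℕ) :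
    √(1 - q) / t * (√(1 - q) ^ k / qFactorial q k * ∑' j, innerTermCN t q k j) =
      expCoeff t q k := by
  have hr : 0 < 1 - q := by linarith [(abs_lt.1 hq).2]
  have hr' : √(1 - q) ≠ 0 := (Real.sqrt_pos.2 hr).ne'
  have hk := qFactorial_ne_zero hq k
  simp only [innerTermCN_eq_tsum]
  rw [tsum_eq_tsum_antidiagonal (summable_besselTerm hq _ k), ← mul_assoc, ← tsum_mul_left,
    expCoeff]
  refine tsum_congr fun m => ?_
  -- Everything becomes a power of `r = √(1 - q)`: `r ^ (k + 1)` from the prefactors and `r ^ (2 *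
  -- m)` from `(1 - q) ^ m` cancel the denominator `r ^ (2 * m + k + 1)`.
  rw [sum_antidiagonal_besselTerm hq, ← Real.sq_sqrt hr.le, Real.sqrt_sq (Real.sqrt_nonneg _)]
  generalize √(1 - q) = r at hr'
  have h : ((2 * m + k).factorial : ℝ) ≠ 0 := by positivity
  rw [div_pow]
  field_simp
  ring

theorem outerTermCN_eq {q t : ℝ} (hq : |q| < 1) (ht : t ≠ 0) (y ρ : ℝ) (k : ℕ) :
    √(1 - q) / t * outerTermCN t y ρ q k = ρ ^ k * qHermite q y k * expCoeff t q k := by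
  have hr : 0 ≤ 1 - q := by linarith [(abs_lt.1 hq).2]
  have h : (1 - q) ^ ((k : ℝ) / 2) = √(1 - q) ^ k := by
    rw [Real.sqrt_eq_rpow, ← Real.rpow_natCast, ← Real.rpow_mul hr]
    ring_nf
  rw [outerTermCN, h, ← tsum_innerTermCN hq ht k]
  ring

/-- Reduces (ii) to the inner series with `k = 0`, where the `q`-factorials cancel. -/
theorem termN_eq {q : ℝ} (hq : |q| < 1) (t : ℝ) : termN t q = innerTermCN t q 0 := by
  ext j
  rw [termN, innerTermCN, zero_add, add_zero, Nat.choose_two_right, Nat.add_sub_cancel,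
    mul_comm (j + 1) j, mul_div_cancel_left₀ _ (qFactorial_ne_zero hq j)]
  push_cast
  ring

theorem phiN_eq {q t : ℝ} (hq : |q| < 1) (ht : t ≠ 0) : phiN t q = expCoeff t q 0 := by
  rw [phiN, termN_eq hq, ← tsum_innerTermCN hq ht 0, pow_zero, qFactorial_zero, div_one, one_mul]

theorem summable_outerTermCN {q t : ℝ} (hq : |q| < 1) (ht : t ≠ 0) (y ρ : ℝ) :
    Summable (outerTermCN t y ρ q) := by
  have hr : 0 < 1 - q := by linarith [(abs_lt.1 hq).2]
  have h := summable_hermite_expCoeff hq.le t y ρ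
  simp only [← outerTermCN_eq hq ht] at h
  exact (summable_mul_left_iff (div_ne_zero (Real.sqrt_pos.2 hr).ne' ht)).1 h

theorem phiCN_eq {q t : ℝ} (hq : |q| < 1) (ht : t ≠ 0) (y ρ : ℝ) :
    phiCN t y ρ q = ∑' k, ρ ^ k * qHermite q y k * expCoeff t q k := by
  simp only [phiCN, ← tsum_mul_left, outerTermCN_eq hq ht]

end QNormal

theorem mainTheorem4 :
    (∀ n m : ℕ, 1 ≤ n → 2 * m ≤ n →
      Tendsto (fun q : ℝ => QNormal.coeffC m n q / (1 - q) ^ m) (𝓝[<] 1)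
        (𝓝 ((n.factorial : ℝ) / (2 ^ m * (m.factorial : ℝ) * ((n - 2 * m).factorial : ℝ))))) ∧
    (∀ t : ℝ, t ≠ 0 →
      (∀ q ∈ Set.Ioo (-1 : ℝ) 1, Summable (QNormal.termN t q)) ∧
      Tendsto (fun q : ℝ => QNormal.phiN t q) (𝓝[<] 1) (𝓝 (Real.exp (t ^ 2 / 2)))) ∧
    (∀ t y ρ : ℝ, t ≠ 0 → |ρ| < 1 →
      (∀ q ∈ Set.Ioo (-1 : ℝ) 1,
        (∀ k : ℕ, Summable (QNormal.innerTermCN t q k)) ∧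
        Summable (QNormal.outerTermCN t y ρ q)) ∧
      Tendsto (fun q : ℝ => QNormal.phiCN t y ρ q) (𝓝[<] 1)
        (𝓝 (Real.exp (t * ρ * y + (1 - ρ ^ 2) * t ^ 2 / 2)))) := by
  refine ⟨fun n m _ hm => ?_, fun t ht => ⟨fun q hq => ?_, ?_⟩,
    fun t y ρ ht _ => ⟨fun q hq => ⟨fun k => ?_, ?_⟩, ?_⟩⟩
  · obtain ⟨l, rfl⟩ := Nat.exists_eq_add_of_le hm
    rw [Nat.add_sub_cancel_left]
    exact QNormal.tendsto_coeffC m l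
  · rw [QNormal.termN_eq (abs_lt.2 hq)]
    exact QNormal.summable_innerTermCN (abs_lt.2 hq) t 0
  · have h := QNormal.tendsto_expCoeff t 0
    rw [pow_zero, Nat.factorial_zero, Nat.cast_one, div_one, one_mul] at h
    refine h.congr' ?_
    filter_upwards [QNormal.eventually_abs_lt_one] with q hq
    exact (QNormal.phiN_eq hq ht).symm
  · exact QNormal.summable_innerTermCN (abs_lt.2 hq) t k
  · exact QNormal.summable_outerTermCN (abs_lt.2 hq) ht y ρ
  · refine (QNormal.tendsto_tsum_hermite_expCoeff t y ρ).congr' ?_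
    filter_upwards [QNormal.eventually_abs_lt_one] with q hq
    exact (QNormal.phiCN_eq hq ht y ρ).symm
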